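/- Let $\mathbb K$ be a field, let $r,s\in\mathbb K$ be a primitive $d$-th and a primitive $d'$-th root of unity ($d,d'\ge 1$), let $\ell=\mathrm{lcm}(d,d')$, and assume that $\ell$ is coprime to $3$, $r^3\neq s^3$ and $r^4\neq s^4$. Put $r_1=r$, $r_2=r^3$, $s_1=s$, $s_2=s^3$ and $$p_{11}=rs^{-1},\quad p_{12}=r^{-3},\quad p_{21}=s^{3},\quad p_{22}=r^3s^{-3}.$$ Let $U=U_{r,s}(G_2)$ be the unital associative $\mathbb K$-algebra generated by $e_i,f_i,\omega_i^{\pm1},\omega_i'^{\pm1}$ ($i=1,2$) subject to the following relations: the elements $\omega_i^{\pm1},\omega_j'^{\pm1}$ all commute with each other, and $\omega_i\omega_i^{-1}=1=\omega_i'\omega_i'^{-1}$; $$\omega_je_i\omega_j^{-1}=p_{ij}e_i,\quad \omega_jf_i\omega_j^{-1}=p_{ij}^{-1}f_i,\quad \omega_i'e_j\omega_i'^{-1}=p_{ij}^{-1}e_j,\quad \omega_i'f_j\omega_i'^{-1}=p_{ij}f_j;$$ $$e_if_j-f_je_i=\delta_{ij}\,\frac{\omega_i-\omega_i'}{r_i-s_i};$$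 $$e_2^2e_1-(r^{-3}+s^{-3})e_2e_1e_2+(rs)^{-3}e_1e_2^2=0,$$ $$e_1^4e_2-(r+s)(r^2+s^2)e_1^3e_2e_1+rs(r^2+s^2)(r^2+rs+s^2)e_1^2e_2e_1^2-(rs)^3(r+s)(r^2+s^2)e_1e_2e_1^3+(rs)^6e_2e_1^4=0;$$ and the two relations obtained from the last two by replacing each $e_i$ by $f_i$ and reversing the order of the factors in every monomial. Let $\varepsilon$ be the counit, i.e. the algebra homomorphism to $\mathbb K$ with $\varepsilon(e_i)=\varepsilon(f_i)=0$ and $\varepsilon(\omega_i^{\pm1})=\varepsilon(\omega_i'^{\pm1})=1$. Define the root vectors $E_i=e_i$, $F_i=f_i$, $$E_{12}=e_1e_2-s^3e_2e_1,\quad E_{112}=e_1E_{12}-rs^2E_{12}e_1,\quad E_{1112}=e_1E_{112}-r^2sE_{112}e_1,\quad E_{11212}=E_{112}E_{12}-r^2sE_{12}E_{112},$$ $$F_{12}=f_2f_1-r^3f_1f_2,\quad F_{112}=F_{12}f_1-r^2sf_1F_{12},\quad F_{1112}=F_{112}f_1-rs^2f_1F_{112},\quad F_{11212}=F_{12}F_{112}-rs^2F_{112}F_{12}.$$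 Let $\mathfrak u=\mathfrak u_{r,s}(G_2)$ be the quotient of $U$ by the two-sided ideal generated by the $\ell$-th powers of these twelve root vectors and by $\omega_k^\ell-1$, $\omega_k'^\ell-1$ ($k=1,2$), with the induced counit, again denoted $\varepsilon$, and let $\mathfrak b\subseteq\mathfrak u$ be the Borel subalgebra generated by $e_i,\omega_i^{\pm1}$ ($i=1,2$), with the restricted counit. An element $y\in\mathfrak b$ is called a left (resp. right) integral of $\mathfrak b$ if $ay=\varepsilon(a)y$ (resp. $ya=\varepsilon(a)y$) for all $a\in\mathfrak b$. Proposition 6.2. In $\mathfrak b$, let $$t=\prod_{i=1}^{2}\bigl(1+\omega_i+\dots+\omega_i^{\ell-1}\bigr),\qquad x=E_2^{\ell-1}E_{12}^{\ell-1}E_{11212}^{\ell-1}E_{112}^{\ell-1}E_{1112}^{\ell-1}E_1^{\ell-1}.$$ Then $tx$ is a left integral of $\mathfrak b$ and $xt$ is a right integral of $\mathfrak b$. Moreover, $\mathfrak b$ is not semisimple. -/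

import Mathlib

namespace G2Quantum

universe u v

/-! ### Quantum root vectors, in an arbitrary algebra -/

/-- The six positive roots of `G₂`, indexed by the words of their root vectors:
`E₁`, `E₂`, `E₁₂`, `E₁₁₂`, `E₁₁₁₂`, `E₁₁₂₁₂` have degrees `α₁`, `α₂`, `α₁+α₂`, `2α₁+α₂`,
`3α₁+α₂`, `3α₁+2α₂`. -/
inductive PosRoot : Type
  | r1 | r2 | r12 | r112 | r1112 | r11212

section RootVectors

variable {K : Type u} [Field K] {A : Type v} [Ring A] [Algebra K A]

/-- `E₁₂ = e₁e₂ - s³e₂e₁`. -/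
def E12 (_r s : K) (e₁ e₂ : A) : A := e₁ * e₂ - s ^ 3 • (e₂ * e₁)

/-- `E₁₁₂ = e₁E₁₂ - rs²E₁₂e₁`. -/
def E112 (r s : K) (e₁ e₂ : A) : A :=
  e₁ * E12 r s e₁ e₂ - (r * s ^ 2) • (E12 r s e₁ e₂ * e₁)

/-- `E₁₁₁₂ = e₁E₁₁₂ - r²sE₁₁₂e₁`. -/
def E1112 (r s : K) (e₁ e₂ : A) : A :=
  e₁ * E112 r s e₁ e₂ - (r ^ 2 * s) • (E112 r s e₁ e₂ * e₁)

/-- `E₁₁₂₁₂ = E₁₁₂E₁₂ - r²sE₁₂E₁₁₂`. -/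
def E11212 (r s : K) (e₁ e₂ : A) : A :=
  E112 r s e₁ e₂ * E12 r s e₁ e₂ - (r ^ 2 * s) • (E12 r s e₁ e₂ * E112 r s e₁ e₂)

/-- `F₁₂ = f₂f₁ - r³f₁f₂`. -/
def F12 (r _s : K) (f₁ f₂ : A) : A := f₂ * f₁ - r ^ 3 • (f₁ * f₂)

/-- `F₁₁₂ = F₁₂f₁ - r²sf₁F₁₂`. -/
def F112 (r s : K) (f₁ f₂ : A) : A :=
  F12 r s f₁ f₂ * f₁ - (r ^ 2 * s) • (f₁ * F12 r s f₁ f₂)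

/-- `F₁₁₁₂ = F₁₁₂f₁ - rs²f₁F₁₁₂`. -/
def F1112 (r s : K) (f₁ f₂ : A) : A :=
  F112 r s f₁ f₂ * f₁ - (r * s ^ 2) • (f₁ * F112 r s f₁ f₂)

/-- `F₁₁₂₁₂ = F₁₂F₁₁₂ - rs²F₁₁₂F₁₂`. -/
def F11212 (r s : K) (f₁ f₂ : A) : A :=
  F12 r s f₁ f₂ * F112 r s f₁ f₂ - (r * s ^ 2) • (F112 r s f₁ f₂ * F12 r s f₁ f₂)

/-- The positive root vector `E_α`. -/
def rootE (r s : K) (e₁ e₂ : A) : PosRoot → A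
  | .r1 => e₁
  | .r2 => e₂
  | .r12 => E12 r s e₁ e₂
  | .r112 => E112 r s e₁ e₂
  | .r1112 => E1112 r s e₁ e₂
  | .r11212 => E11212 r s e₁ e₂

/-- The negative root vector `F_α`. -/
def rootF (r s : K) (f₁ f₂ : A) : PosRoot → A
  | .r1 => f₁
  | .r2 => f₂
  | .r12 => F12 r s f₁ f₂
  | .r112 => F112 r s f₁ f₂
  | .r1112 => F1112 r s f₁ f₂
  | .r11212 => F11212 r s f₁ f₂

end RootVectors

/-! ### The two-parameter quantum group `U_{r,s}(G₂)`

The indices `1, 2` are represented by `0, 1 : Fin 2`. -/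

/-- The symbols `ω_i`, `ω_i⁻¹`, `ω_i'`, `ω_i'⁻¹`. -/
inductive Tor : Type
  | w (i : Fin 2) | wInv (i : Fin 2) | w' (i : Fin 2) | w'Inv (i : Fin 2)

/-- The symbols `e_i`, `f_i` and `ω_i^{±1}`, `ω_i'^{±1}`. -/
inductive Gen : Type
  | e (i : Fin 2) | f (i : Fin 2) | tor (t : Tor)

section Algebras

variable {K : Type u} [Field K]

/-- The matrix `(⟨ω_i', ω_j⟩)` of structure constants. -/
def pairing (r s : K) : Matrix (Fin 2) (Fin 2) K :=
  !![r * s⁻¹, r⁻¹ ^ 3; s ^ 3, r ^ 3 * s⁻¹ ^ 3]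

/-- `r_1 = r`, `r_2 = r³` (and likewise for `s`). -/
def simplePow (r : K) : Fin 2 → K := ![r, r ^ 3]

variable (K) in
/-- A generator as an element of the free algebra. -/
abbrev ge (i : Fin 2) : FreeAlgebra K Gen := FreeAlgebra.ι K (Gen.e i)

variable (K) in
/-- A generator as an element of the free algebra. -/
abbrev gf (i : Fin 2) : FreeAlgebra K Gen := FreeAlgebra.ι K (Gen.f i)

variable (K) in
/-- A generator as an element of the free algebra. -/
abbrev gt (t : Tor) : FreeAlgebra K Gen := FreeAlgebra.ι K (Gen.tor t)

open Tor in
/-- The defining relations of `U_{r,s}(G₂)`. The four toral families `w_e`, `w_f`, `w'_e`, `w'_f`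
list all conjugation relations at once: `ω_j e_i ω_j⁻¹ = ⟨ω_i', ω_j⟩ e_i`,
`ω_j f_i ω_j⁻¹ = ⟨ω_i', ω_j⟩⁻¹ f_i`, `ω_i' e_j ω_i'⁻¹ = ⟨ω_i', ω_j⟩⁻¹ e_j`,
`ω_i' f_j ω_i'⁻¹ = ⟨ω_i', ω_j⟩ f_j`. -/
inductive Rel (r s : K) : FreeAlgebra K Gen → FreeAlgebra K Gen → Prop
  | tor_comm (t t' : Tor) : Rel r s (gt K t * gt K t') (gt K t' * gt K t)
  | w_inv (i : Fin 2) : Rel r s (gt K (w i) * gt K (wInv i)) 1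
  | w'_inv (i : Fin 2) : Rel r s (gt K (w' i) * gt K (w'Inv i)) 1
  | w_e (i j : Fin 2) :
      Rel r s (gt K (w j) * ge K i * gt K (wInv j)) (pairing r s i j • ge K i)
  | w_f (i j : Fin 2) :
      Rel r s (gt K (w j) * gf K i * gt K (wInv j)) ((pairing r s i j)⁻¹ • gf K i)
  | w'_e (i j : Fin 2) :
      Rel r s (gt K (w' i) * ge K j * gt K (w'Inv i)) ((pairing r s i j)⁻¹ • ge K j)
  | w'_f (i j : Fin 2) :
      Rel r s (gt K (w' i) * gf K j * gt K (w'Inv i)) (pairing r s i j • gf K j)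
  | e_f_same (i : Fin 2) :
      Rel r s (ge K i * gf K i - gf K i * ge K i)
        ((simplePow r i - simplePow s i)⁻¹ • (gt K (w i) - gt K (w' i)))
  | e_f_diff (i j : Fin 2) (hij : i ≠ j) :
      Rel r s (ge K i * gf K j - gf K j * ge K i) 0
  | serre_e_221 :
      Rel r s (ge K 1 ^ 2 * ge K 0
        - (r⁻¹ ^ 3 + s⁻¹ ^ 3) • (ge K 1 * ge K 0 * ge K 1)
        + ((r * s)⁻¹ ^ 3) • (ge K 0 * ge K 1 ^ 2)) 0
  | serre_e_11112 :
      Rel r s (ge K 0 ^ 4 * ge K 1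
        - ((r + s) * (r ^ 2 + s ^ 2)) • (ge K 0 ^ 3 * ge K 1 * ge K 0)
        + (r * s * (r ^ 2 + s ^ 2) * (r ^ 2 + r * s + s ^ 2)) •
            (ge K 0 ^ 2 * ge K 1 * ge K 0 ^ 2)
        - ((r * s) ^ 3 * (r + s) * (r ^ 2 + s ^ 2)) • (ge K 0 * ge K 1 * ge K 0 ^ 3)
        + ((r * s) ^ 6) • (ge K 1 * ge K 0 ^ 4)) 0
  | serre_f_122 :
      Rel r s (gf K 0 * gf K 1 ^ 2
        - (r⁻¹ ^ 3 + s⁻¹ ^ 3) • (gf K 1 * gf K 0 * gf K 1)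
        + ((r * s)⁻¹ ^ 3) • (gf K 1 ^ 2 * gf K 0)) 0
  | serre_f_21111 :
      Rel r s (gf K 1 * gf K 0 ^ 4
        - ((r + s) * (r ^ 2 + s ^ 2)) • (gf K 0 * gf K 1 * gf K 0 ^ 3)
        + (r * s * (r ^ 2 + s ^ 2) * (r ^ 2 + r * s + s ^ 2)) •
            (gf K 0 ^ 2 * gf K 1 * gf K 0 ^ 2)
        - ((r * s) ^ 3 * (r + s) * (r ^ 2 + s ^ 2)) • (gf K 0 ^ 3 * gf K 1 * gf K 0)
        + ((r * s) ^ 6) • (gf K 0 ^ 4 * gf K 1)) 0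

/-- The two-parameter quantum group `U_{r,s}(G₂)`, as an algebra. -/
def U (r s : K) : Type u := RingQuot (Rel r s)

instance (r s : K) : Ring (U r s) := inferInstanceAs (Ring (RingQuot (Rel r s)))

instance (r s : K) : Algebra K (U r s) := inferInstanceAs (Algebra K (RingQuot (Rel r s)))

/-- The quotient map from the free algebra to `U_{r,s}(G₂)`. -/
def U.mk (r s : K) : FreeAlgebra K Gen →ₐ[K] U r s := RingQuot.mkAlgHom K (Rel r s)

/-- The image of a generator in `U_{r,s}(G₂)`. -/
def U.gen (r s : K) (g : Gen) : U r s := U.mk r s (FreeAlgebra.ι K g)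

/-- The counit of the free algebra: `e_i, f_i ↦ 0` and `ω_i^{±1}, ω_i'^{±1} ↦ 1`. -/
def freeCounit : FreeAlgebra K Gen →ₐ[K] K :=
  FreeAlgebra.lift K fun g => match g with
    | .e _ => 0
    | .f _ => 0
    | .tor _ => 1

/-- The counit `ε` of `U_{r,s}(G₂)`. -/
def U.counit (r s : K) : U r s →ₐ[K] K :=
  RingQuot.liftAlgHom K ⟨freeCounit, by
    intro x y h
    cases h <;> simp [freeCounit]⟩

/-! ### The restricted quantum group `𝔲_{r,s}(G₂)` and its Borel subalgebra `𝔟` -/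

/-- The relations `E_α^ℓ = 0`, `F_α^ℓ = 0`, `ω_k^ℓ = 1`, `(ω_k')^ℓ = 1` on `U_{r,s}(G₂)`. -/
inductive RestrictedRel (r s : K) (l : ℕ) : U r s → U r s → Prop
  | E_pow (α : PosRoot) :
      RestrictedRel r s l (rootE r s (U.gen r s (.e 0)) (U.gen r s (.e 1)) α ^ l) 0
  | F_pow (α : PosRoot) :
      RestrictedRel r s l (rootF r s (U.gen r s (.f 0)) (U.gen r s (.f 1)) α ^ l) 0
  | w_pow (k : Fin 2) : RestrictedRel r s l (U.gen r s (.tor (.w k)) ^ l) 1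
  | w'_pow (k : Fin 2) : RestrictedRel r s l (U.gen r s (.tor (.w' k)) ^ l) 1

/-- The restricted quantum group: the quotient of `U_{r,s}(G₂)` by the two-sided ideal generated by
all `E_α^ℓ`, `F_α^ℓ`, `ω_k^ℓ - 1`, `(ω_k')^ℓ - 1`. -/
def SmallU (r s : K) (l : ℕ) : Type u := RingQuot (RestrictedRel r s l)

instance (r s : K) (l : ℕ) : Ring (SmallU r s l) :=
  inferInstanceAs (Ring (RingQuot (RestrictedRel r s l)))

instance (r s : K) (l : ℕ) : Algebra K (SmallU r s l) :=
  inferInstanceAs (Algebra K (RingQuot (RestrictedRel r s l)))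

/-- The quotient map from `U_{r,s}(G₂)` to `𝔲_{r,s}(G₂)`. -/
def SmallU.mk (r s : K) (l : ℕ) : U r s →ₐ[K] SmallU r s l :=
  RingQuot.mkAlgHom K (RestrictedRel r s l)

/-- The image of a generator in `𝔲_{r,s}(G₂)`. -/
def SmallU.gen (r s : K) (l : ℕ) (g : Gen) : SmallU r s l := SmallU.mk r s l (U.gen r s g)

theorem U.counit_gen (r s : K) (g : Gen) :
    U.counit r s (U.gen r s g) = freeCounit (FreeAlgebra.ι K g) :=
  RingQuot.liftAlgHom_mkAlgHom_apply K freeCounit _ _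

/-- The counit `ε` of `𝔲_{r,s}(G₂)`, induced by that of `U_{r,s}(G₂)`. -/
def SmallU.counit (r s : K) (l : ℕ) (hl : 0 < l) : SmallU r s l →ₐ[K] K :=
  RingQuot.liftAlgHom K ⟨U.counit r s, by
    have h0 : l ≠ 0 := hl.ne'
    intro x y h
    cases h with
    | E_pow α =>
      cases α <;>
        simp [rootE, E12, E112, E1112, E11212, U.counit_gen, freeCounit, h0]
    | F_pow α =>
      cases α <;>
        simp [rootF, F12, F112, F1112, F11212, U.counit_gen, freeCounit, h0]
    | w_pow k => simp [U.counit_gen, freeCounit]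
    | w'_pow k => simp [U.counit_gen, freeCounit]⟩

/-- The generators `e_i`, `ω_i`, `ω_i⁻¹` of the Borel subalgebra. -/
inductive IsBorelGen : Gen → Prop
  | e (i : Fin 2) : IsBorelGen (.e i)
  | w (i : Fin 2) : IsBorelGen (.tor (.w i))
  | wInv (i : Fin 2) : IsBorelGen (.tor (.wInv i))

/-- The Borel subalgebra `𝔟` of `𝔲_{r,s}(G₂)`, generated by `e_i`, `ω_i^{±1}`. -/
def borel (r s : K) (l : ℕ) : Subalgebra K (SmallU r s l) :=
  Algebra.adjoin K (SmallU.gen r s l '' {g | IsBorelGen g})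

/-- The counit of `𝔟`, i.e. the restriction of that of `𝔲_{r,s}(G₂)`. -/
def borelCounit (r s : K) (l : ℕ) (hl : 0 < l) : borel r s l →ₐ[K] K :=
  (SmallU.counit r s l hl).comp (borel r s l).val

/-- `e_i` as an element of `𝔟`. -/
def be (r s : K) (l : ℕ) (i : Fin 2) : borel r s l :=
  ⟨SmallU.gen r s l (.e i), Algebra.subset_adjoin ⟨_, .e i, rfl⟩⟩

/-- `ω_i` as an element of `𝔟`. -/
def bw (r s : K) (l : ℕ) (i : Fin 2) : borel r s l :=
  ⟨SmallU.gen r s l (.tor (.w i)), Algebra.subset_adjoin ⟨_, .w i, rfl⟩⟩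

/-- The root vector `E_α` as an element of `𝔟`. -/
def bE (r s : K) (l : ℕ) (α : PosRoot) : borel r s l :=
  rootE r s (be r s l 0) (be r s l 1) α

/-- `t = ∏_{i = 1, 2} (1 + ω_i + ⋯ + ω_i^{ℓ-1})`. -/
def tElt (r s : K) (l : ℕ) : borel r s l :=
  (∑ k ∈ Finset.range l, bw r s l 0 ^ k) * (∑ k ∈ Finset.range l, bw r s l 1 ^ k)

/-- `x = E₂^{ℓ-1} E₁₂^{ℓ-1} E₁₁₂₁₂^{ℓ-1} E₁₁₂^{ℓ-1} E₁₁₁₂^{ℓ-1} E₁^{ℓ-1}`. -/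
def xElt (r s : K) (l : ℕ) : borel r s l :=
  bE r s l .r2 ^ (l - 1) * bE r s l .r12 ^ (l - 1) * bE r s l .r11212 ^ (l - 1) *
    bE r s l .r112 ^ (l - 1) * bE r s l .r1112 ^ (l - 1) * bE r s l .r1 ^ (l - 1)

end Algebras

/-! ### Integrals -/

section Integrals

variable {K : Type u} [Field K] {H : Type v} [Ring H] [Algebra K H]

/-- `y` is a left integral of `H` with counit `ε`: `a y = ε(a) y` for all `a`. -/
def IsLeftIntegral (ε : H →ₐ[K] K) (y : H) : Prop := ∀ a : H, a * y = ε a • y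

/-- `y` is a right integral of `H` with counit `ε`: `y a = ε(a) y` for all `a`. -/
def IsRightIntegral (ε : H →ₐ[K] K) (y : H) : Prop := ∀ a : H, y * a = ε a • y

end Integrals

end G2Quantum

/-!
Only generators have to be tested for an integral, and by the `q`-commutation of `e_i` with the `ω_j`
together with `ω_j t = t = t ω_j`, everything reduces to `e_i x = 0 = x e_i`. Two of these four
equations, `e₂ x = 0` and `x e₁ = 0`, are immediate from `E_α ^ ℓ = 0`. The other two rest on the
Levendorskii–Soibelman straightening relations: with respect to the convex order in which the factors
of `x` are written, interchanging two root vectors costs a scalar and monomials in root vectors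
strictly in between. Hence pushing `e₁` from the left (or `e₂` from the right) through the powers
in `x` only creates root vectors that in turn can be pushed until they meet their own power
`E_α ^ (ℓ - 1)` (`Straightening.mul_top_eq_zero`, `Straightening.top_mul_eq_zero`). The straightening
relations follow from the two Serre relations by applying successive `q`-commutators with `e₁` and
`e₂` (`straightening_of_serre`). This involves division by `r + s`, `r² + s²` and `r² - rs + s²`,
which are nonzero since `r⁴ ≠ s⁴` and `ℓ` is coprime to `3`.

For the failure of semisimplicity, `𝔲_{r,s}(G₂)` acts on the `7`-dimensional space whose weights are
the short roots and `0` (`repSmallU`). The root vectors are nilpotent there of index at most `4`,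
while `ℓ ≥ 4`. A semisimple ring is von Neumann regular, so `e₁ = e₁ c e₁` for some `c ∈ 𝔟` if `𝔟` is
semisimple. But `e₁` maps some weight vector to a highest weight vector, which spans a line that is
stable under `𝔟` and killed by `e₁`, so `e₁ c e₁` vanishes on that weight vector and `e₁` does not
(`not_isSemisimpleRing_borel`).
-/

namespace G2Quantum

/-! ### Straightening relations among the positive root vectors -/

section Straightening

variable {K : Type*} [Field K] {A : Type*} [Ring A] [Algebra K A]

/-- The Levendorskii–Soibelman relations for the convex order
`E₂ < E₁₂ < E₁₁₂₁₂ < E₁₁₂ < E₁₁₁₂ < E₁`, for elements `a, b, X, Y, Z, W` in the roles of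
`E₁, E₂, E₁₂, E₁₁₂, E₁₁₁₂, E₁₁₂₁₂`: a product in the wrong order is a multiple of the product in
the right order, up to monomials in root vectors lying strictly between the two factors. -/
structure Straightening (r s γ : K) (a b X Y Z W : A) : Prop where
  a_b : a * b = s ^ 3 • (b * a) + X
  a_X : a * X = (r * s ^ 2) • (X * a) + Y
  a_Y : a * Y = (r ^ 2 * s) • (Y * a) + Z
  a_Z : a * Z = r ^ 3 • (Z * a)
  a_W : a * W = (r ^ 3 * s ^ 3) • (W * a) + γ • (Y * Y)
  X_b : X * b = r ^ 3 • (b * X)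
  Y_b : Y * b = (r ^ 3 * s ^ 3) • (b * Y) + (r * (r ^ 2 - s ^ 2)) • (X * X)
  Z_b : Z * b = (r ^ 3 * s ^ 6) • (b * Z) +
    ((r ^ 2 * s * (r ^ 3 - s ^ 3)) • (X * Y) + (r * (r ^ 2 - r * s - s ^ 2)) • W)
  W_b : W * b = (r ^ 6 * s ^ 3) • (b * W) + ((r ^ 2 - s ^ 2) * (r ^ 4 - r ^ 3 * s)) • (X * X * X)
  Y_X : Y * X = (r ^ 2 * s) • (X * Y) + W
  Z_X : Z * X = (r ^ 3 * s ^ 3) • (X * Z) + γ • (Y * Y)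
  W_X : W * X = r ^ 3 • (X * W)
  Y_W : Y * W = r ^ 3 • (W * Y)
  Z_W : Z * W = (r ^ 6 * s ^ 3) • (W * Z) + (γ * (r ^ 3 - r ^ 2 * s)) • (Y * Y * Y)
  Z_Y : Z * Y = r ^ 3 • (Y * Z)

/-- The straightening relations follow from the two Serre relations. -/
theorem straightening_of_serre {r s : K} (hr : r ≠ 0) (hs : s ≠ 0) (h2 : r + s ≠ 0)
    (h4 : r ^ 2 + s ^ 2 ≠ 0) (h6 : r ^ 2 - r * s + s ^ 2 ≠ 0) {a b : A}
    (serre₁ : b ^ 2 * a - (r⁻¹ ^ 3 + s⁻¹ ^ 3) • (b * a * b) + ((r * s)⁻¹ ^ 3) • (a * b ^ 2) = 0)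
    (serre₂ : a ^ 4 * b - ((r + s) * (r ^ 2 + s ^ 2)) • (a ^ 3 * b * a)
        + (r * s * (r ^ 2 + s ^ 2) * (r ^ 2 + r * s + s ^ 2)) • (a ^ 2 * b * a ^ 2)
        - ((r * s) ^ 3 * (r + s) * (r ^ 2 + s ^ 2)) • (a * b * a ^ 3)
        + ((r * s) ^ 6) • (b * a ^ 4) = 0) :
    Straightening r s (r * (r ^ 3 - s ^ 3) / (r + s)) a b (E12 r s a b) (E112 r s a b)
      (E1112 r s a b) (E11212 r s a b) := by
  have a_b : a * b = s ^ 3 • (b * a) + E12 r s a b := by simp [E12]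
  have a_X : a * E12 r s a b = (r * s ^ 2) • (E12 r s a b * a) + E112 r s a b := by
    simp [E112]
  have a_Y : a * E112 r s a b = (r ^ 2 * s) • (E112 r s a b * a) + E1112 r s a b := by
    simp [E1112]
  have Y_X : E112 r s a b * E12 r s a b =
      (r ^ 2 * s) • (E12 r s a b * E112 r s a b) + E11212 r s a b := by
    simp [E11212]
  have X_b : E12 r s a b * b = r ^ 3 • (b * E12 r s a b) := by
    have c₁ : (r * s) ^ 3 * (r⁻¹ ^ 3 + s⁻¹ ^ 3) = r ^ 3 + s ^ 3 := by field_simp; ring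
    have c₂ : (r * s) ^ 3 * (r * s)⁻¹ ^ 3 = 1 := by field_simp
    have h := congrArg ((r * s) ^ 3 • ·) serre₁
    simp only [smul_add, smul_sub, smul_smul, c₁, c₂, smul_zero] at h
    linear_combination (norm := skip) h
    simp only [E12, mul_sub, sub_mul, smul_mul_assoc, mul_smul_comm, smul_sub, smul_smul,
      pow_succ, pow_zero, one_mul, mul_assoc]
    module
  have a_Z : a * E1112 r s a b = r ^ 3 • (E1112 r s a b * a) := by
    linear_combination (norm := skip) serre₂
    simp only [E12, E112, E1112, mul_sub, sub_mul, smul_mul_assoc, mul_smul_comm, pow_succ,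
      pow_zero, one_mul, mul_assoc]
    module
  have hγ : r * (r ^ 3 - s ^ 3) / (r + s) * (r + s) = r * (r ^ 3 - s ^ 3) :=
    div_mul_cancel₀ _ h2
  -- From here on, only the quadratic relations matter.
  generalize E12 r s a b = X at *
  generalize E112 r s a b = Y at *
  generalize E1112 r s a b = Z at *
  generalize E11212 r s a b = W at *
  generalize r * (r ^ 3 - s ^ 3) / (r + s) = γ at *
  -- Each of them comes from evaluating one cubic overlap in two ways: `a X b` gives `Y_b`, `a Y b`
  -- gives `Z_b`, `a Z b` gives `Z_X`, `Z X b` gives `W_X`, and so on.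
  have Y_b : Y * b = (r ^ 3 * s ^ 3) • (b * Y) + (r * (r ^ 2 - s ^ 2)) • (X * X) := by
    linear_combination (norm := skip) a * X_b - a_X * b - (r * s ^ 2) • (X * a_b)
      + r ^ 3 • (a_b * X) - (r * s ^ 5) • (X_b * a) + (r ^ 3 * s ^ 3) • (b * a_X)
    simp only [mul_add, add_mul, smul_mul_assoc, mul_smul_comm, mul_assoc]
    module
  have Z_b : Z * b = (r ^ 3 * s ^ 6) • (b * Z) +
      ((r ^ 2 * s * (r ^ 3 - s ^ 3)) • (X * Y) + (r * (r ^ 2 - r * s - s ^ 2)) • W) := by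
    linear_combination (norm := skip) a * Y_b - a_Y * b - (r ^ 2 * s) • (Y * a_b)
      + (r ^ 3 * s ^ 3) • (a_b * Y) + (r ^ 3 * s ^ 6) • (b * a_Y)
      + (r * (r ^ 2 - s ^ 2)) • (a_X * X + (r * s ^ 2) • (X * a_X) + Y_X)
      - (r ^ 2 * s ^ 4) • (Y_b * a) - (r ^ 2 * s) • Y_X
    simp only [mul_add, add_mul, smul_mul_assoc, mul_smul_comm, mul_assoc, smul_add]
    module
  have a_W' : a * W = (r ^ 3 * s ^ 3) • (W * a) + (Z * X - (r ^ 3 * s ^ 3) • (X * Z)) := by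
    linear_combination (norm := skip) -(a * Y_X) + a_Y * X + (r ^ 2 * s) • (Y * a_X)
      - (r ^ 2 * s) • (a_X * Y) - (r ^ 3 * s ^ 3) • (X * a_Y) + (r ^ 3 * s ^ 3) • (Y_X * a)
    simp only [mul_add, add_mul, smul_mul_assoc, mul_smul_comm, mul_assoc, smul_add]
    module
  have Z_X : Z * X = (r ^ 3 * s ^ 3) • (X * Z) + γ • (Y * Y) := by
    refine smul_right_injective A (mul_ne_zero (mul_ne_zero hr hs) h2) ?_
    linear_combination (norm := skip) a * Z_b - a_Z * b - r ^ 3 • (Z * a_b)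
      - (r ^ 3 * s ^ 3) • (Z_b * a) + (r ^ 3 * s ^ 6) • (a_b * Z) + (r ^ 3 * s ^ 9) • (b * a_Z)
      + (r ^ 2 * s * (r ^ 3 - s ^ 3)) • (a_X * Y + (r * s ^ 2) • (X * a_Y))
      + (r * (r ^ 2 - r * s - s ^ 2)) • a_W' - (r * s) • (hγ • (Y * Y))
    simp only [mul_add, add_mul, smul_mul_assoc, mul_smul_comm, mul_assoc, smul_add]
    module
  have a_W : a * W = (r ^ 3 * s ^ 3) • (W * a) + γ • (Y * Y) := by
    rw [a_W', Z_X, add_sub_cancel_left]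
  have Z_Y : Z * Y = r ^ 3 • (Y * Z) := by
    refine smul_right_injective A (mul_ne_zero (mul_ne_zero hr hs) h4) ?_
    -- The coefficient of `Z * Y` that arises is `r ^ 3 - γ`, and
    -- `(r + s) * (r ^ 3 - γ) = r * s * (r ^ 2 + s ^ 2)`.
    linear_combination (norm := skip) (r + s) • (a * Z_X - a_Z * X - r ^ 3 • (Z * a_X)
      - (r ^ 4 * s ^ 2) • (Z_X * a) + (r ^ 3 * s ^ 3) • (a_X * Z)
      + (r ^ 4 * s ^ 5) • (X * a_Z) + γ • (a_Y * Y + (r ^ 2 * s) • (Y * a_Y)))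
      + hγ • (Z * Y) + (r ^ 2 * s) • (hγ • (Y * Z))
    simp only [mul_add, add_mul, smul_mul_assoc, mul_smul_comm, mul_assoc, smul_add]
    module
  have W_b : W * b = (r ^ 6 * s ^ 3) • (b * W) +
      ((r ^ 2 - s ^ 2) * (r ^ 4 - r ^ 3 * s)) • (X * X * X) := by
    linear_combination (norm := skip) -(Y_X * b) + Y * X_b + r ^ 3 • (Y_b * X)
      - (r ^ 2 * s) • (X * Y_b) - (r ^ 5 * s ^ 4) • (X_b * Y) + (r ^ 6 * s ^ 3) • (b * Y_X)
    simp only [mul_add, add_mul, smul_mul_assoc, mul_smul_comm, mul_assoc, smul_add]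
    module
  have W_X : W * X = r ^ 3 • (X * W) := by
    -- This is the coefficient of `W * X` that arises, up to sign, after clearing the denominator of `γ`.
    have h0 : r ^ 2 * s ^ 2 * (r ^ 2 - r * s + s ^ 2) * (r + s) ≠ 0 := by
      simp [hr, hs, h2, h6]
    refine smul_right_injective A h0 ?_
    linear_combination (norm := skip) -((r + s) • (Z_X * b - Z * X_b - r ^ 3 • (Z_b * X)
      + (r ^ 3 * s ^ 3) • (X * Z_b) + (r ^ 6 * s ^ 9) • (X_b * Z)
      + γ • (Y * Y_b + (r ^ 3 * s ^ 3) • (Y_b * Y)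
        + (r * (r ^ 2 - s ^ 2)) • (Y_X * X + (r ^ 2 * s) • (X * Y_X)))
      - (r ^ 6 * s ^ 6) • (b * Z_X)
      - (r ^ 3 * (r ^ 2 * s * (r ^ 3 - s ^ 3))) • (X * Y_X)))
      - (r * (r ^ 2 - s ^ 2)) • (hγ • (W * X) + (r ^ 2 * s) • (hγ • (X * W))
        + (r ^ 4 * s ^ 2 + r ^ 3 * s ^ 3) • (hγ • (X * X * Y)))
    simp only [mul_add, add_mul, smul_mul_assoc, mul_smul_comm, mul_assoc, smul_add]
    module
  have Y_W : Y * W = r ^ 3 • (W * Y) := by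
    refine smul_right_injective A (mul_ne_zero (mul_ne_zero hr hs) h4) ?_
    linear_combination (norm := skip) (r + s) • (-(a * W_X) + a_W * X
      + (r ^ 3 * s ^ 3) • (W * a_X) + γ • (Y * Y_X + (r ^ 2 * s) • (Y_X * Y))
      - r ^ 3 • (a_X * W) - (r ^ 4 * s ^ 2) • (X * a_W) + (r ^ 4 * s ^ 5) • (W_X * a))
      + hγ • (Y * W) + (r ^ 2 * s) • (hγ • (W * Y))
    simp only [mul_add, add_mul, smul_mul_assoc, mul_smul_comm, mul_assoc, smul_add]
    module
  have Z_W : Z * W = (r ^ 6 * s ^ 3) • (W * Z) + (γ * (r ^ 3 - r ^ 2 * s)) • (Y * Y * Y) := by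
    linear_combination (norm := skip) a * Y_W - a_Y * W - (r ^ 2 * s) • (Y * a_W)
      + r ^ 3 • (a_W * Y) + (r ^ 6 * s ^ 3) • (W * a_Y) - (r ^ 5 * s ^ 4) • (Y_W * a)
    simp only [mul_add, add_mul, smul_mul_assoc, mul_smul_comm, mul_assoc, smul_add]
    module
  exact ⟨a_b, a_X, a_Y, a_Z, a_W, X_b, Y_b, Z_b, W_b, Y_X, Z_X, W_X, Y_W, Z_W, Z_Y⟩

end Straightening

/-! ### Annihilation of the top PBW monomial -/

section Vanishing

variable {K : Type*} [Field K] {A : Type*} [Ring A] [Algebra K A]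

/-- If `u` `q`-commutes with `v` up to `m`, and `m` annihilates every `vᵏ P` from the left, then `u`
can be moved through a power of `v` towards a factor `P` that it annihilates. -/
theorem mul_pow_mul_eq_zero {u v m P : A} {q : K} (h : u * v = q • (v * u) + m)
    (hm : ∀ k, m * (v ^ k * P) = 0) (hu : u * P = 0) (n : ℕ) : u * (v ^ n * P) = 0 := by
  induction n with
  | zero => simpa using hu
  | succ n ih =>
    rw [pow_succ', mul_assoc, ← mul_assoc, h, add_mul, hm, add_zero, smul_mul_assoc, mul_assoc, ih,
      mul_zero, smul_zero]

/-- The mirror image of `mul_pow_mul_eq_zero`. -/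
theorem mul_pow_mul_eq_zero' {u v m Q : A} {q : K} (h : v * u = q • (u * v) + m)
    (hm : ∀ k, Q * v ^ k * m = 0) (hu : Q * u = 0) (n : ℕ) : Q * v ^ n * u = 0 := by
  induction n with
  | zero => simpa using hu
  | succ n ih =>
    rw [pow_succ, ← mul_assoc, mul_assoc, h, mul_add, hm, add_zero, mul_smul_comm, ← mul_assoc, ih,
      zero_mul, smul_zero]

theorem add_zero_of_eq {u v w : A} {q : K} (h : u * v = q • w) : u * v = q • w + 0 := by
  rw [h, add_zero]

namespace Straightening

variable {r s γ : K} {a b X Y Z W : A}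

/-- `E₁` annihilates the top PBW monomial from the left: moving it to the right through each power
only creates root vectors `E_β` that reach `E_β ^ n` and give `E_β ^ (n + 1) = 0`. -/
theorem mul_top_eq_zero (R : Straightening r s γ a b X Y Z W) {n : ℕ} (ha : a ^ (n + 1) = 0)
    (hX : X ^ (n + 1) = 0) (hY : Y ^ (n + 1) = 0) (hZ : Z ^ (n + 1) = 0)
    (hW : W ^ (n + 1) = 0) :
    a * (b ^ n * (X ^ n * (W ^ n * (Y ^ n * (Z ^ n * a ^ n))))) = 0 := by
  have top {v : A} (hv : v ^ (n + 1) = 0) (P : A) : v * (v ^ n * P) = 0 := by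
    rw [← mul_assoc, ← pow_succ', hv, zero_mul]
  have hZ₅ := top hZ (a ^ n)
  have ha₅ : a * (Z ^ n * a ^ n) = 0 :=
    mul_pow_mul_eq_zero (add_zero_of_eq R.a_Z) (by simp) (by rw [← pow_succ', ha]) n
  generalize Z ^ n * a ^ n = P₅ at *
  have hY₄ := top hY P₅
  have hZY : ∀ k, Z * (Y ^ k * P₅) = 0 :=
    mul_pow_mul_eq_zero (add_zero_of_eq R.Z_Y) (by simp) hZ₅
  have ha₄ := mul_pow_mul_eq_zero R.a_Y hZY ha₅ n
  generalize Y ^ n * P₅ = P₄ at *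
  have hW₃ := top hW P₄
  have hYW : ∀ k, Y * (W ^ k * P₄) = 0 :=
    mul_pow_mul_eq_zero (add_zero_of_eq R.Y_W) (by simp) hY₄
  have ha₃ := mul_pow_mul_eq_zero R.a_W
    (fun k => by rw [smul_mul_assoc, mul_assoc, hYW, mul_zero, smul_zero]) ha₄ n
  have hY₃ := hYW n
  generalize W ^ n * P₄ = P₃ at *
  have hX₂ := top hX P₃
  have hWX : ∀ k, W * (X ^ k * P₃) = 0 :=
    mul_pow_mul_eq_zero (add_zero_of_eq R.W_X) (by simp) hW₃
  have hYX : ∀ k, Y * (X ^ k * P₃) = 0 := mul_pow_mul_eq_zero R.Y_X hWX hY₃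
  have ha₂ := mul_pow_mul_eq_zero R.a_X hYX ha₃ n
  generalize X ^ n * P₃ = P₂ at *
  have hXb : ∀ k, X * (b ^ k * P₂) = 0 :=
    mul_pow_mul_eq_zero (add_zero_of_eq R.X_b) (by simp) hX₂
  exact mul_pow_mul_eq_zero R.a_b hXb ha₂ n

/-- `E₂` annihilates the top PBW monomial from the right. -/
theorem top_mul_eq_zero (R : Straightening r s γ a b X Y Z W) {n : ℕ} (hb : b ^ (n + 1) = 0)
    (hX : X ^ (n + 1) = 0) (hY : Y ^ (n + 1) = 0) (hZ : Z ^ (n + 1) = 0)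
    (hW : W ^ (n + 1) = 0) :
    b ^ n * X ^ n * W ^ n * Y ^ n * Z ^ n * a ^ n * b = 0 := by
  have top {v : A} (hv : v ^ (n + 1) = 0) (Q : A) : Q * v ^ n * v = 0 := by
    rw [mul_assoc, ← pow_succ, hv, mul_zero]
  have hb₁ : b ^ n * b = 0 := by rw [← pow_succ, hb]
  generalize b ^ n = Q₁ at *
  have hX₂ := top hX Q₁
  have hb₂ := mul_pow_mul_eq_zero' (add_zero_of_eq R.X_b) (by simp) hb₁ n
  generalize Q₁ * X ^ n = Q₂ at *
  have hW₃ := top hW Q₂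
  have hXW : ∀ k, Q₂ * W ^ k * X = 0 :=
    mul_pow_mul_eq_zero' (add_zero_of_eq R.W_X) (by simp) hX₂
  have hX₃ := hXW n
  have hb₃ := mul_pow_mul_eq_zero' R.W_b (fun k => by
    rw [mul_smul_comm, ← mul_assoc, ← mul_assoc, hXW, zero_mul, zero_mul, smul_zero]) hb₂ n
  generalize Q₂ * W ^ n = Q₃ at *
  have hY₄ := top hY Q₃
  have hWY : ∀ k, Q₃ * Y ^ k * W = 0 :=
    mul_pow_mul_eq_zero' (add_zero_of_eq R.Y_W) (by simp) hW₃
  have hXY : ∀ k, Q₃ * Y ^ k * X = 0 := mul_pow_mul_eq_zero' R.Y_X hWY hX₃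
  have hb₄ := mul_pow_mul_eq_zero' R.Y_b (fun k => by
    rw [mul_smul_comm, ← mul_assoc, hXY, zero_mul, smul_zero]) hb₃ n
  have hW₄ := hWY n
  have hX₄ := hXY n
  generalize Q₃ * Y ^ n = Q₄ at *
  have hZ₅ := top hZ Q₄
  have hYZ : ∀ k, Q₄ * Z ^ k * Y = 0 :=
    mul_pow_mul_eq_zero' (add_zero_of_eq R.Z_Y) (by simp) hY₄
  have hWZ : ∀ k, Q₄ * Z ^ k * W = 0 := mul_pow_mul_eq_zero' R.Z_W (fun k => by
    rw [mul_smul_comm, ← mul_assoc, ← mul_assoc, hYZ, zero_mul, zero_mul, smul_zero]) hW₄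
  have hXZ : ∀ k, Q₄ * Z ^ k * X = 0 := mul_pow_mul_eq_zero' R.Z_X (fun k => by
    rw [mul_smul_comm, ← mul_assoc, hYZ, zero_mul, smul_zero]) hX₄
  have hb₅ := mul_pow_mul_eq_zero' R.Z_b (fun k => by
    rw [mul_add, mul_smul_comm, mul_smul_comm, ← mul_assoc, hXZ, hWZ, zero_mul, smul_zero,
      smul_zero, add_zero]) hb₄ n
  have hY₅ := hYZ n
  have hX₅ := hXZ n
  generalize Q₄ * Z ^ n = Q₅ at *
  have hZa : ∀ k, Q₅ * a ^ k * Z = 0 :=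
    mul_pow_mul_eq_zero' (add_zero_of_eq R.a_Z) (by simp) hZ₅
  have hYa : ∀ k, Q₅ * a ^ k * Y = 0 := mul_pow_mul_eq_zero' R.a_Y hZa hY₅
  have hXa : ∀ k, Q₅ * a ^ k * X = 0 := mul_pow_mul_eq_zero' R.a_X hYa hX₅
  exact mul_pow_mul_eq_zero' R.a_b hXa hb₅ n

end Straightening
end Vanishing

/-! ### Integrals of the Borel subalgebra -/

theorem rootE_map {K : Type*} [Field K] {A B : Type*} [Ring A] [Algebra K A] [Ring B] [Algebra K B]
    (f : A →ₐ[K] B) (r s : K) (e₁ e₂ : A) (α : PosRoot) :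
    f (rootE r s e₁ e₂ α) = rootE r s (f e₁) (f e₂) α := by
  cases α <;> simp [rootE, E12, E112, E1112, E11212]

theorem rootF_map {K : Type*} [Field K] {A B : Type*} [Ring A] [Algebra K A] [Ring B] [Algebra K B]
    (f : A →ₐ[K] B) (r s : K) (f₁ f₂ : A) (α : PosRoot) :
    f (rootF r s f₁ f₂ α) = rootF r s (f f₁) (f f₂) α := by
  cases α <;> simp [rootF, F12, F112, F1112, F11212]

section Borel

variable {K : Type*} [Field K] (r s : K) (l : ℕ)

theorem SmallU.mk_rel {x y : U r s} (h : RestrictedRel r s l x y) :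
    SmallU.mk r s l x = SmallU.mk r s l y :=
  RingQuot.mkAlgHom_rel K h

theorem U.mk_rel {x y : FreeAlgebra K Gen} (h : Rel r s x y) : U.mk r s x = U.mk r s y :=
  RingQuot.mkAlgHom_rel K h

/-- The composite of the quotient maps `K⟨Gen⟩ → U → 𝔲`. -/
def SmallU.ofFree : FreeAlgebra K Gen →ₐ[K] SmallU r s l := (SmallU.mk r s l).comp (U.mk r s)

theorem SmallU.ofFree_ι (g : Gen) :
    SmallU.ofFree r s l (FreeAlgebra.ι K g) = SmallU.gen r s l g := rfl

variable {r s} in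
theorem SmallU.ofFree_rel {x y : FreeAlgebra K Gen} (h : Rel r s x y) :
    SmallU.ofFree r s l x = SmallU.ofFree r s l y :=
  congrArg (SmallU.mk r s l) (U.mk_rel r s h)

theorem SmallU.counit_gen (hl : 0 < l) (g : Gen) :
    SmallU.counit r s l hl (SmallU.gen r s l g) = freeCounit (FreeAlgebra.ι K g) :=
  (RingQuot.liftAlgHom_mkAlgHom_apply K (U.counit r s) _ _).trans (U.counit_gen r s g)

theorem val_be (i : Fin 2) : (borel r s l).val (be r s l i) = SmallU.gen r s l (.e i) := rfl

theorem val_bw (i : Fin 2) : (borel r s l).val (bw r s l i) = SmallU.gen r s l (.tor (.w i)) := rfl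

theorem bE_pow (α : PosRoot) : bE r s l α ^ l = 0 := by
  apply Subtype.val_injective
  change (borel r s l).val (bE r s l α ^ l) = 0
  rw [map_pow, bE, rootE_map, val_be, val_be, SmallU.gen, SmallU.gen, ← rootE_map, ← map_pow,
    SmallU.mk_rel r s l (.E_pow α), map_zero]

theorem bw_pow (i : Fin 2) : bw r s l i ^ l = 1 := by
  apply Subtype.val_injective
  change (borel r s l).val (bw r s l i ^ l) = 1
  rw [map_pow, val_bw, SmallU.gen, ← map_pow, SmallU.mk_rel r s l (.w_pow i), map_one]

theorem bw_comm (i j : Fin 2) : bw r s l i * bw r s l j = bw r s l j * bw r s l i := by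
  have h := SmallU.ofFree_rel (r := r) (s := s) l (.tor_comm (.w i) (.w j))
  rw [map_mul, map_mul] at h
  exact Subtype.val_injective h

theorem gen_wInv_mul_gen_w (i : Fin 2) :
    SmallU.gen r s l (.tor (.wInv i)) * SmallU.gen r s l (.tor (.w i)) = 1 := by
  have h₁ := SmallU.ofFree_rel (r := r) (s := s) l (.tor_comm (.wInv i) (.w i))
  have h₂ := SmallU.ofFree_rel (r := r) (s := s) l (.w_inv i)
  simpa only [map_mul, SmallU.ofFree_ι, map_one] using h₁.trans h₂

theorem gen_w_mul_gen_wInv (i : Fin 2) :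
    SmallU.gen r s l (.tor (.w i)) * SmallU.gen r s l (.tor (.wInv i)) = 1 := by
  simpa only [map_mul, SmallU.ofFree_ι, map_one] using
    SmallU.ofFree_rel (r := r) (s := s) l (.w_inv i)

/-- `ω_j e_i = p_{ij} e_i ω_j`. -/
theorem bw_mul_be (i j : Fin 2) :
    bw r s l j * be r s l i = pairing r s i j • (be r s l i * bw r s l j) := by
  apply Subtype.val_injective
  change SmallU.gen r s l (.tor (.w j)) * SmallU.gen r s l (.e i) =
    pairing r s i j • (SmallU.gen r s l (.e i) * SmallU.gen r s l (.tor (.w j)))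
  have h := SmallU.ofFree_rel (r := r) (s := s) l (.w_e i j)
  simp only [map_mul, SmallU.ofFree_ι, map_smul] at h
  rw [← smul_mul_assoc, ← h, mul_assoc _ _ (SmallU.gen r s l (.tor (.w j))), gen_wInv_mul_gen_w,
    mul_one]

theorem be_serre₁ : be r s l 1 ^ 2 * be r s l 0
      - (r⁻¹ ^ 3 + s⁻¹ ^ 3) • (be r s l 1 * be r s l 0 * be r s l 1)
      + ((r * s)⁻¹ ^ 3) • (be r s l 0 * be r s l 1 ^ 2) = 0 := by
  have h := SmallU.ofFree_rel (r := r) (s := s) l .serre_e_221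
  simp only [map_add, map_sub, map_smul, map_mul, map_pow, SmallU.ofFree_ι, map_zero] at h
  exact Subtype.val_injective h

theorem be_serre₂ : be r s l 0 ^ 4 * be r s l 1
      - ((r + s) * (r ^ 2 + s ^ 2)) • (be r s l 0 ^ 3 * be r s l 1 * be r s l 0)
      + (r * s * (r ^ 2 + s ^ 2) * (r ^ 2 + r * s + s ^ 2)) •
          (be r s l 0 ^ 2 * be r s l 1 * be r s l 0 ^ 2)
      - ((r * s) ^ 3 * (r + s) * (r ^ 2 + s ^ 2)) • (be r s l 0 * be r s l 1 * be r s l 0 ^ 3)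
      + ((r * s) ^ 6) • (be r s l 1 * be r s l 0 ^ 4) = 0 := by
  have h := SmallU.ofFree_rel (r := r) (s := s) l .serre_e_11112
  simp only [map_add, map_sub, map_smul, map_mul, map_pow, SmallU.ofFree_ι, map_zero] at h
  exact Subtype.val_injective h

/-- An element of `𝔟` on which `e_i` and `ω_i` act from the left through the counit is a left
integral; the action of `ω_i⁻¹` is then forced. -/
theorem isLeftIntegral_of_generators (hl : 0 < l) {y : borel r s l}
    (he : ∀ i, be r s l i * y = 0) (hw : ∀ i, bw r s l i * y = y) :
    IsLeftIntegral (borelCounit r s l hl) y := by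
  rintro ⟨c, hc⟩
  refine Subtype.val_injective ?_
  change c * y.1 = SmallU.counit r s l hl c • y.1
  induction hc using Algebra.adjoin_induction with
  | mem c hc =>
    obtain ⟨_, ⟨i⟩ | ⟨i⟩ | ⟨i⟩, rfl⟩ := hc
    · have h : SmallU.gen r s l (.e i) * y.1 = 0 := congrArg Subtype.val (he i)
      simpa [SmallU.counit_gen, freeCounit] using h
    · have h : SmallU.gen r s l (.tor (.w i)) * y.1 = y.1 := congrArg Subtype.val (hw i)
      simpa [SmallU.counit_gen, freeCounit] using h
    · have h : SmallU.gen r s l (.tor (.w i)) * y.1 = y.1 := congrArg Subtype.val (hw i)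
      conv_lhs => rw [← h, ← mul_assoc, gen_wInv_mul_gen_w, one_mul]
      simp [SmallU.counit_gen, freeCounit]
  | algebraMap c => rw [AlgHom.commutes, Algebra.algebraMap_self, RingHom.id_apply,
      Algebra.smul_def]
  | add c c' _ _ h h' => rw [add_mul, h, h', map_add, add_smul]
  | mul c c' _ _ h h' => rw [mul_assoc, h', mul_smul_comm, h, map_mul, smul_smul, mul_comm]

/-- The mirror image of `isLeftIntegral_of_generators`. -/
theorem isRightIntegral_of_generators (hl : 0 < l) {y : borel r s l}
    (he : ∀ i, y * be r s l i = 0) (hw : ∀ i, y * bw r s l i = y) :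
    IsRightIntegral (borelCounit r s l hl) y := by
  rintro ⟨c, hc⟩
  refine Subtype.val_injective ?_
  change y.1 * c = SmallU.counit r s l hl c • y.1
  induction hc using Algebra.adjoin_induction with
  | mem c hc =>
    obtain ⟨_, ⟨i⟩ | ⟨i⟩ | ⟨i⟩, rfl⟩ := hc
    · have h : y.1 * SmallU.gen r s l (.e i) = 0 := congrArg Subtype.val (he i)
      simpa [SmallU.counit_gen, freeCounit] using h
    · have h : y.1 * SmallU.gen r s l (.tor (.w i)) = y.1 := congrArg Subtype.val (hw i)
      simpa [SmallU.counit_gen, freeCounit] using h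
    · have h : y.1 * SmallU.gen r s l (.tor (.w i)) = y.1 := congrArg Subtype.val (hw i)
      conv_lhs => rw [← h, mul_assoc, gen_w_mul_gen_wInv, mul_one]
      simp [SmallU.counit_gen, freeCounit]
  | algebraMap c => rw [AlgHom.commutes, Algebra.algebraMap_self, RingHom.id_apply,
      Algebra.smul_def, Algebra.commutes]
  | add c c' _ _ h h' => rw [mul_add, h, h', map_add, add_smul]
  | mul c c' _ _ h h' => rw [← mul_assoc, h, smul_mul_assoc, h', map_mul, smul_smul]

theorem bw_mul_tElt (i : Fin 2) : bw r s l i * tElt r s l = tElt r s l := by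
  have h (j : Fin 2) : bw r s l j * ∑ k ∈ Finset.range l, bw r s l j ^ k =
      ∑ k ∈ Finset.range l, bw r s l j ^ k := by
    rw [← sub_eq_zero, ← sub_one_mul, mul_geom_sum, bw_pow, sub_self]
  have hc : Commute (bw r s l 1) (∑ k ∈ Finset.range l, bw r s l 0 ^ k) :=
    Commute.sum_right _ _ _ fun k _ => Commute.pow_right (bw_comm r s l 1 0) k
  match i with
  | 0 => rw [tElt, ← mul_assoc, h]
  | 1 => rw [tElt, ← mul_assoc, hc.eq, mul_assoc, h]

theorem tElt_mul_bw (i : Fin 2) : tElt r s l * bw r s l i = tElt r s l := by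
  have hc : Commute (bw r s l i) (tElt r s l) := by
    refine Commute.mul_right ?_ ?_ <;>
      exact Commute.sum_right _ _ _ fun k _ => Commute.pow_right (bw_comm r s l i _) k
  rw [← hc.eq, bw_mul_tElt]

variable {r s} in
theorem pairing_ne_zero (hr : r ≠ 0) (hs : s ≠ 0) (i j : Fin 2) : pairing r s i j ≠ 0 := by
  fin_cases i <;> fin_cases j <;> simp [pairing, hr, hs]

variable {r s l} in
/-- Moving `e_i` across `t` only rescales the `ω_j` in `t`. -/
theorem exists_be_mul_tElt (hr : r ≠ 0) (hs : s ≠ 0) (i : Fin 2) :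
    ∃ t', be r s l i * tElt r s l = t' * be r s l i := by
  have h (j : Fin 2) : ∃ t', SemiconjBy (be r s l i) (∑ k ∈ Finset.range l, bw r s l j ^ k) t' := by
    have hp := pairing_ne_zero hr hs i j
    have hj : SemiconjBy (be r s l i) (bw r s l j) ((pairing r s i j)⁻¹ • bw r s l j) := by
      rw [SemiconjBy, smul_mul_assoc, bw_mul_be, inv_smul_smul₀ hp]
    refine ⟨∑ k ∈ Finset.range l, ((pairing r s i j)⁻¹ • bw r s l j) ^ k, ?_⟩
    rw [SemiconjBy, Finset.mul_sum, Finset.sum_mul]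
    exact Finset.sum_congr rfl fun k _ => hj.pow_right k
  obtain ⟨u, hu⟩ := h 0
  obtain ⟨v, hv⟩ := h 1
  exact ⟨u * v, hu.mul_right hv⟩

variable {r s l} in
theorem exists_tElt_mul_be (i : Fin 2) :
    ∃ t', tElt r s l * be r s l i = be r s l i * t' := by
  have h (j : Fin 2) :
      ∃ t', SemiconjBy (be r s l i) t' (∑ k ∈ Finset.range l, bw r s l j ^ k) := by
    have hj : SemiconjBy (be r s l i) (pairing r s i j • bw r s l j) (bw r s l j) := by
      rw [SemiconjBy, mul_smul_comm, bw_mul_be]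
    refine ⟨∑ k ∈ Finset.range l, (pairing r s i j • bw r s l j) ^ k, ?_⟩
    rw [SemiconjBy, Finset.mul_sum, Finset.sum_mul]
    exact Finset.sum_congr rfl fun k _ => hj.pow_right k
  obtain ⟨u, hu⟩ := h 0
  obtain ⟨v, hv⟩ := h 1
  exact ⟨u * v, (hu.mul_right hv).eq.symm⟩

variable {r s l}

theorem be_mul_xElt (R : ∃ γ, Straightening r s γ (be r s l 0) (be r s l 1) (bE r s l .r12)
      (bE r s l .r112) (bE r s l .r1112) (bE r s l .r11212)) (hl : 0 < l) (i : Fin 2) :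
    be r s l i * xElt r s l = 0 := by
  obtain ⟨γ, R⟩ := R
  have h (α) : bE r s l α ^ (l - 1 + 1) = 0 := by rw [Nat.sub_add_cancel hl, bE_pow]
  match i with
  | 0 =>
    simp only [xElt, mul_assoc]
    exact R.mul_top_eq_zero (h .r1) (h .r12) (h .r112) (h .r1112) (h .r11212)
  | 1 =>
    have h₂ : be r s l 1 * be r s l 1 ^ (l - 1) = 0 := by rw [← pow_succ']; exact h .r2
    change be r s l 1 * (be r s l 1 ^ (l - 1) * _ * _ * _ * _ * _) = 0
    simp only [← mul_assoc, h₂, zero_mul]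

theorem xElt_mul_be (R : ∃ γ, Straightening r s γ (be r s l 0) (be r s l 1) (bE r s l .r12)
      (bE r s l .r112) (bE r s l .r1112) (bE r s l .r11212)) (hl : 0 < l) (i : Fin 2) :
    xElt r s l * be r s l i = 0 := by
  obtain ⟨γ, R⟩ := R
  have h (α) : bE r s l α ^ (l - 1 + 1) = 0 := by rw [Nat.sub_add_cancel hl, bE_pow]
  match i with
  | 0 =>
    have h₁ : be r s l 0 ^ (l - 1) * be r s l 0 = 0 := by rw [← pow_succ]; exact h .r1
    change _ * be r s l 0 ^ (l - 1) * be r s l 0 = 0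
    rw [mul_assoc, h₁, mul_zero]
  | 1 => exact R.top_mul_eq_zero (h .r2) (h .r12) (h .r112) (h .r1112) (h .r11212)

theorem isLeftIntegral_tElt_mul_xElt (hr : r ≠ 0) (hs : s ≠ 0) (h2 : r + s ≠ 0)
    (h4 : r ^ 2 + s ^ 2 ≠ 0) (h6 : r ^ 2 - r * s + s ^ 2 ≠ 0) (hl : 0 < l) :
    IsLeftIntegral (borelCounit r s l hl) (tElt r s l * xElt r s l) := by
  have R := straightening_of_serre hr hs h2 h4 h6 (be_serre₁ r s l) (be_serre₂ r s l)
  refine isLeftIntegral_of_generators r s l hl (fun i => ?_) fun i => ?_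
  · obtain ⟨t', ht'⟩ := exists_be_mul_tElt (l := l) hr hs i
    rw [← mul_assoc, ht', mul_assoc, be_mul_xElt ⟨_, R⟩ hl, mul_zero]
  · rw [← mul_assoc, bw_mul_tElt]

theorem isRightIntegral_xElt_mul_tElt (hr : r ≠ 0) (hs : s ≠ 0) (h2 : r + s ≠ 0)
    (h4 : r ^ 2 + s ^ 2 ≠ 0) (h6 : r ^ 2 - r * s + s ^ 2 ≠ 0) (hl : 0 < l) :
    IsRightIntegral (borelCounit r s l hl) (xElt r s l * tElt r s l) := by
  have R := straightening_of_serre hr hs h2 h4 h6 (be_serre₁ r s l) (be_serre₂ r s l)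
  refine isRightIntegral_of_generators r s l hl (fun i => ?_) fun i => ?_
  · obtain ⟨t', ht'⟩ := exists_tElt_mul_be (r := r) (s := s) (l := l) i
    rw [mul_assoc, ht', ← mul_assoc, xElt_mul_be ⟨_, R⟩ hl, zero_mul]
  · rw [mul_assoc, tElt_mul_bw]

end Borel

/-! ### The seven-dimensional representation -/

section Representation

open Matrix

variable {K : Type*} [Field K]

/-- A `7 × 7` matrix that raises the grading of `K⁷` by the position of the basis vector by at
least `k`. -/
def Raises (k : ℕ) (M : Matrix (Fin 7) (Fin 7) K) : Prop :=
  ∀ i j : Fin 7, (j : ℕ) < i + k → M i j = 0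

theorem Raises.mul {k m : ℕ} {M N : Matrix (Fin 7) (Fin 7) K} (hM : Raises k M)
    (hN : Raises m N) : Raises (k + m) (M * N) := by
  intro i j hij
  rw [Matrix.mul_apply]
  refine Finset.sum_eq_zero fun x _ => ?_
  rcases lt_or_ge (x : ℕ) (i + k) with h | h
  · rw [hM i x h, zero_mul]
  · rw [hN x j (by omega), mul_zero]

theorem Raises.sub_smul {k : ℕ} {M N : Matrix (Fin 7) (Fin 7) K} (hM : Raises k M)
    (hN : Raises k N) (c : K) : Raises k (M - c • N) := by
  intro i j hij
  simp [hM i j hij, hN i j hij]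

theorem Raises.mono {k m : ℕ} {M : Matrix (Fin 7) (Fin 7) K} (hM : Raises m M) (h : k ≤ m) :
    Raises k M := fun i j hij => hM i j (by omega)

theorem Raises.pow_eq_zero {M : Matrix (Fin 7) (Fin 7) K} (hM : Raises 2 M) {l : ℕ} (hl : 4 ≤ l) :
    M ^ l = 0 := by
  refine pow_eq_zero_of_le hl ?_
  ext i j
  have h : Raises 8 (M * M * (M * M)) := (hM.mul hM).mul (hM.mul hM)
  rw [show M ^ 4 = M * M * (M * M) by rw [← sq, ← pow_two, ← pow_mul]]
  exact h i j (by omega)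

/-- Root vectors built from matrices `e₁, e₂` that raise the grading are nilpotent. -/
theorem rootE_pow_eq_zero {r s : K} {e₁ e₂ : Matrix (Fin 7) (Fin 7) K} (h₁ : Raises 1 e₁)
    (h₂ : Raises 1 e₂) (h₁' : e₁ ^ 3 = 0) (h₂' : e₂ ^ 2 = 0) {l : ℕ} (hl : 4 ≤ l) (α : PosRoot) :
    rootE r s e₁ e₂ α ^ l = 0 := by
  have h12 : Raises 2 (E12 r s e₁ e₂) := (h₁.mul h₂).sub_smul (h₂.mul h₁) _
  have h112 : Raises 3 (E112 r s e₁ e₂) := (h₁.mul h12).sub_smul (h12.mul h₁) _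
  have h1112 : Raises 4 (E1112 r s e₁ e₂) := (h₁.mul h112).sub_smul (h112.mul h₁) _
  have h11212 : Raises 5 (E11212 r s e₁ e₂) := (h112.mul h12).sub_smul (h12.mul h112) _
  cases α with
  | r1 => exact pow_eq_zero_of_le (by omega) h₁'
  | r2 => exact pow_eq_zero_of_le (by omega) h₂'
  | r12 => exact h12.pow_eq_zero hl
  | r112 => exact (h112.mono (by omega)).pow_eq_zero hl
  | r1112 => exact (h1112.mono (by omega)).pow_eq_zero hl
  | r11212 => exact (h11212.mono (by omega)).pow_eq_zero hl

/-- Transposition exchanges the roles of the root vectors `E_α` and `F_α`. -/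
theorem rootF_eq_transpose (r s : K) (f₁ f₂ : Matrix (Fin 7) (Fin 7) K) (α : PosRoot) :
    rootF r s f₁ f₂ α = (rootE s r f₁ᵀ f₂ᵀ α)ᵀ := by
  cases α <;> simp [rootE, rootF, E12, E112, E1112, E11212, F12, F112, F1112, F11212, mul_comm]

/-- The coordinates, in the basis `α₁, α₂`, of the weights of the `7`-dimensional representation:
the short roots and `0`, ordered by decreasing height, so that the `e_i` are strictly upper
triangular. -/
def weight (v : Fin 7) : Fin 2 → ℤ :=
  ![![2, 1, 1, 0, -1, -1, -2] v, ![1, 1, 0, 0, 0, -1, -1] v]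

/-- The eigenvalue of `ω_j` on the weight vector `v`. -/
def wEigen (r s : K) (j : Fin 2) (v : Fin 7) : K :=
  pairing r s 0 j ^ weight v 0 * pairing r s 1 j ^ weight v 1

/-- The eigenvalue of `ω_j'` on the weight vector `v`. -/
def w'Eigen (r s : K) (i : Fin 2) (v : Fin 7) : K :=
  ((pairing r s i 0)⁻¹) ^ weight v 0 * ((pairing r s i 1)⁻¹) ^ weight v 1

/-- `e₁` and `e₂` on the `7`-dimensional representation. The weight vectors are scaled such that all
nonzero entries are `1`. -/
def eMat : Fin 2 → Matrix (Fin 7) (Fin 7) K :=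
  ![single 0 1 1 + single 2 3 1 + single 3 4 1 + single 5 6 1, single 1 2 1 + single 4 5 1]

/-- `f₁` and `f₂` on the `7`-dimensional representation; the entries are forced by the commutators
`[e_i, f_i]`. -/
def fMat (r s : K) : Fin 2 → Matrix (Fin 7) (Fin 7) K :=
  ![single 1 0 (r * s) + single 3 2 ((r + s) / (r * s)) + single 4 3 ((r + s) / (r * s)) +
      single 6 5 ((r * s)⁻¹ ^ 2),
    single 2 1 ((r * s)⁻¹ ^ 3) + single 5 4 1]

/-- The images of the generators under the `7`-dimensional representation. -/
def genMat (r s : K) : Gen → Matrix (Fin 7) (Fin 7) K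
  | .e i => eMat i
  | .f i => fMat r s i
  | .tor (.w j) => diagonal (wEigen r s j)
  | .tor (.wInv j) => diagonal fun v => (wEigen r s j v)⁻¹
  | .tor (.w' j) => diagonal (w'Eigen r s j)
  | .tor (.w'Inv j) => diagonal fun v => (w'Eigen r s j v)⁻¹

theorem eMat_raises (i : Fin 2) : Raises 1 (eMat i : Matrix (Fin 7) (Fin 7) K) := by
  intro k l h
  fin_cases i <;> fin_cases k <;> fin_cases l <;>
    first | (exfalso; revert h; decide) | simp [eMat, single]

theorem eMat_weight {i : Fin 2} {k l : Fin 7} (h : (eMat i : Matrix (Fin 7) (Fin 7) K) k l ≠ 0) :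
    weight k = weight l + Pi.single i 1 := by
  revert h
  fin_cases i <;> fin_cases k <;> fin_cases l <;>
    first | (intro; decide) | simp [eMat, single]

theorem fMat_weight (r s : K) {i : Fin 2} {k l : Fin 7} (h : fMat r s i k l ≠ 0) :
    weight l = weight k + Pi.single i 1 := by
  revert h
  fin_cases i <;> fin_cases k <;> fin_cases l <;>
    first | (intro; decide) | simp [fMat, single]

variable {r s : K}

theorem wEigen_ne_zero (hr : r ≠ 0) (hs : s ≠ 0) (j : Fin 2) (v : Fin 7) : wEigen r s j v ≠ 0 :=
  mul_ne_zero (zpow_ne_zero _ (pairing_ne_zero hr hs _ _))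
    (zpow_ne_zero _ (pairing_ne_zero hr hs _ _))

theorem w'Eigen_ne_zero (hr : r ≠ 0) (hs : s ≠ 0) (j : Fin 2) (v : Fin 7) :
    w'Eigen r s j v ≠ 0 :=
  mul_ne_zero (zpow_ne_zero _ (inv_ne_zero (pairing_ne_zero hr hs _ _)))
    (zpow_ne_zero _ (inv_ne_zero (pairing_ne_zero hr hs _ _)))

theorem wEigen_eq_mul (hr : r ≠ 0) (hs : s ≠ 0) (i j : Fin 2) {k l : Fin 7}
    (h : weight k = weight l + Pi.single i 1) :
    wEigen r s j k = pairing r s i j * wEigen r s j l := by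
  have h₀ := pairing_ne_zero hr hs 0 j
  have h₁ := pairing_ne_zero hr hs 1 j
  fin_cases i <;> simp [wEigen, h, zpow_add₀, h₀, h₁] <;> ring

theorem w'Eigen_eq_mul (hr : r ≠ 0) (hs : s ≠ 0) (i j : Fin 2) {k l : Fin 7}
    (h : weight k = weight l + Pi.single j 1) :
    w'Eigen r s i k = (pairing r s i j)⁻¹ * w'Eigen r s i l := by
  have h₀ := pairing_ne_zero hr hs i 0
  have h₁ := pairing_ne_zero hr hs i 1
  fin_cases j <;> simp [w'Eigen, h, zpow_add₀, h₀, h₁] <;> ring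

theorem pairing_pow {l : ℕ} (hr : r ^ l = 1) (hs : s ^ l = 1) (i j : Fin 2) :
    pairing r s i j ^ l = 1 := by
  fin_cases i <;> fin_cases j <;> simp [pairing, mul_pow, ← pow_mul, mul_comm 3 l] <;>
    simp [pow_mul, hr, hs]

theorem wEigen_pow {l : ℕ} (hr : r ^ l = 1) (hs : s ^ l = 1) (j : Fin 2) (v : Fin 7) :
    wEigen r s j v ^ l = 1 := by
  have h (p : K) (n : ℤ) (hp : p ^ l = 1) : (p ^ n) ^ l = 1 := by
    rw [← zpow_natCast, ← _root_.zpow_mul, mul_comm, _root_.zpow_mul, zpow_natCast, hp, _root_.one_zpow]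
  rw [wEigen, mul_pow, h _ _ (pairing_pow hr hs _ _), h _ _ (pairing_pow hr hs _ _), one_mul]

theorem w'Eigen_pow {l : ℕ} (hr : r ^ l = 1) (hs : s ^ l = 1) (j : Fin 2) (v : Fin 7) :
    w'Eigen r s j v ^ l = 1 := by
  have h (p : K) (n : ℤ) (hp : p ^ l = 1) : (p⁻¹ ^ n) ^ l = 1 := by
    rw [← zpow_natCast, ← _root_.zpow_mul, mul_comm, _root_.zpow_mul, zpow_natCast, inv_pow, hp, inv_one,
      _root_.one_zpow]
  rw [w'Eigen, mul_pow, h _ _ (pairing_pow hr hs _ _), h _ _ (pairing_pow hr hs _ _), one_mul]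

/-- A matrix that shifts the weights of `χ` by the factor `c` is an eigenvector of conjugation by
`diagonal χ`. -/
theorem diagonal_conj {n : Type*} [Fintype n] [DecidableEq n] {χ : n → K} (hχ : ∀ v, χ v ≠ 0)
    {M : Matrix n n K} {c : K} (h : ∀ k l, M k l ≠ 0 → χ k = c * χ l) :
    diagonal χ * M * diagonal (fun v => (χ v)⁻¹) = c • M := by
  ext k l
  rw [mul_diagonal, diagonal_mul, Matrix.smul_apply, smul_eq_mul]
  by_cases hM : M k l = 0
  · simp [hM]
  · rw [h k l hM]
    field_simp [hχ l]

theorem eMat_mul_fMat_sub (hr : r ≠ 0) (hs : s ≠ 0) (h3 : r ^ 3 ≠ s ^ 3) (i : Fin 2) :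
    eMat i * fMat r s i - fMat r s i * eMat i = (simplePow r i - simplePow s i)⁻¹ •
      (diagonal (wEigen r s i) - diagonal (w'Eigen r s i)) := by
  have h3' : r ^ 3 - s ^ 3 ≠ 0 := sub_ne_zero.mpr h3
  have h1 : r - s ≠ 0 := sub_ne_zero.mpr fun h => h3 (by rw [h])
  rw [diagonal_sub, ← diagonal_smul]
  fin_cases i
  · trans diagonal ![r * s, -(r * s), (r + s) / (r * s), 0, -((r + s) / (r * s)),
      (r * s)⁻¹ ^ 2, -(r * s)⁻¹ ^ 2]
    · simp only [eMat, fMat, Fin.zero_eta, cons_val_zero, mul_add,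
        add_mul, single_mul_single_same, one_mul, mul_one]
      simp only [ne_eq, Fin.reduceEq, not_false_eq_true, single_mul_single_of_ne,
        add_zero, zero_add]
      ext k l
      fin_cases k <;> fin_cases l <;> simp [single]
    · congr 1
      funext v
      fin_cases v <;>
        simp [wEigen, w'Eigen, weight, pairing, simplePow] <;>
        field_simp <;> ring
  · trans diagonal ![0, (r * s)⁻¹ ^ 3, -(r * s)⁻¹ ^ 3, 0, 1, -1, 0]
    · simp only [eMat, fMat, Fin.mk_one, cons_val_zero, cons_val_one, mul_add,
        add_mul, single_mul_single_same, one_mul, mul_one]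
      simp only [ne_eq, Fin.reduceEq, not_false_eq_true, single_mul_single_of_ne,
        add_zero, zero_add]
      ext k l
      fin_cases k <;> fin_cases l <;> simp [single]
    · congr 1
      funext v
      fin_cases v <;>
        simp [wEigen, w'Eigen, weight, pairing, simplePow] <;>
        first | (field_simp <;> ring1) | (field_simp; simp)

theorem eMat_mul_fMat_comm (i j : Fin 2) (hij : i ≠ j) :
    eMat i * fMat r s j - fMat r s j * eMat i = 0 := by
  fin_cases i <;> fin_cases j <;> first | (exact absurd rfl hij) | skip
  all_goals simp [eMat, fMat, mul_add, add_mul, single_mul_single_of_ne]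

theorem eMat_zero_pow : (eMat 0 : Matrix (Fin 7) (Fin 7) K) ^ 3 = 0 := by
  simp [eMat, pow_succ, mul_add, add_mul, single_mul_single_of_ne]

theorem eMat_one_sq : (eMat 1 : Matrix (Fin 7) (Fin 7) K) ^ 2 = 0 := by
  simp [eMat, pow_succ, mul_add, add_mul, single_mul_single_of_ne]

theorem eMat_one_zero_one : (eMat 1 : Matrix (Fin 7) (Fin 7) K) * eMat 0 * eMat 1 = 0 := by
  simp [eMat, mul_add, add_mul, single_mul_single_of_ne]

theorem eMat_zero_sq_one_zero_sq :
    (eMat 0 : Matrix (Fin 7) (Fin 7) K) ^ 2 * eMat 1 * eMat 0 ^ 2 = 0 := by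
  simp [eMat, pow_succ, mul_add, add_mul, single_mul_single_of_ne]

theorem fMat_zero_pow : fMat r s 0 ^ 3 = 0 := by
  simp [fMat, pow_succ, mul_add, add_mul, single_mul_single_of_ne]

theorem fMat_one_sq : fMat r s 1 ^ 2 = 0 := by
  simp [fMat, pow_succ, mul_add, add_mul, single_mul_single_of_ne]

theorem fMat_one_zero_one : fMat r s 1 * fMat r s 0 * fMat r s 1 = 0 := by
  simp [fMat, mul_add, add_mul, single_mul_single_of_ne]

theorem fMat_zero_sq_one_zero_sq : fMat r s 0 ^ 2 * fMat r s 1 * fMat r s 0 ^ 2 = 0 := by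
  simp [fMat, pow_succ, mul_add, add_mul, single_mul_single_of_ne]

theorem fMat_transpose_raises (i : Fin 2) : Raises 1 (fMat r s i)ᵀ := by
  intro k l h
  fin_cases i <;> fin_cases k <;> fin_cases l <;>
    first | (exfalso; revert h; decide) | simp [fMat, single]

theorem lift_genMat_rel (hr : r ≠ 0) (hs : s ≠ 0) (h3 : r ^ 3 ≠ s ^ 3) ⦃x y : FreeAlgebra K Gen⦄
    (h : Rel r s x y) :
    FreeAlgebra.lift K (genMat r s) x = FreeAlgebra.lift K (genMat r s) y := by
  have hw := wEigen_ne_zero hr hs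
  have hw' := w'Eigen_ne_zero hr hs
  have he3 := eMat_zero_pow (K := K)
  have he4 : (eMat 0 : Matrix (Fin 7) (Fin 7) K) ^ 4 = 0 := pow_eq_zero_of_le (by omega) he3
  have hf3 := fMat_zero_pow (r := r) (s := s)
  have hf4 : fMat r s 0 ^ 4 = 0 := pow_eq_zero_of_le (by omega) hf3
  cases h with
  | tor_comm t t' =>
    cases t <;> cases t' <;> simp [genMat, diagonal_mul_diagonal, mul_comm]
  | w_inv i => simp [genMat, diagonal_mul_diagonal, hw]
  | w'_inv i => simp [genMat, diagonal_mul_diagonal, hw']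
  | w_e i j =>
    simpa [genMat] using diagonal_conj (hw j) fun k l h =>
      wEigen_eq_mul hr hs i j (eMat_weight h)
  | w_f i j =>
    simpa [genMat] using diagonal_conj (hw j) fun k l h => by
      rw [wEigen_eq_mul hr hs i j (fMat_weight r s h),
        inv_mul_cancel_left₀ (pairing_ne_zero hr hs i j)]
  | w'_e i j =>
    simpa [genMat] using diagonal_conj (hw' i) fun k l h =>
      w'Eigen_eq_mul hr hs i j (eMat_weight h)
  | w'_f i j =>
    simpa [genMat] using diagonal_conj (hw' i) fun k l h => by
      rw [w'Eigen_eq_mul hr hs i j (fMat_weight r s h),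
        mul_inv_cancel_left₀ (pairing_ne_zero hr hs i j)]
  | e_f_same i => simpa [genMat] using eMat_mul_fMat_sub hr hs h3 i
  | e_f_diff i j hij => simpa [genMat] using eMat_mul_fMat_comm i j hij
  | serre_e_221 => simp [genMat, eMat_one_sq, eMat_one_zero_one]
  | serre_e_11112 => simp [genMat, he3, he4, eMat_zero_sq_one_zero_sq]
  | serre_f_122 => simp [genMat, fMat_one_sq, fMat_one_zero_one]
  | serre_f_21111 => simp [genMat, hf3, hf4, fMat_zero_sq_one_zero_sq]

/-- The `7`-dimensional representation of `U_{r,s}(G₂)`. -/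
def repU (hr : r ≠ 0) (hs : s ≠ 0) (h3 : r ^ 3 ≠ s ^ 3) :
    U r s →ₐ[K] Matrix (Fin 7) (Fin 7) K :=
  RingQuot.liftAlgHom K ⟨FreeAlgebra.lift K (genMat r s), lift_genMat_rel hr hs h3⟩

theorem repU_gen (hr : r ≠ 0) (hs : s ≠ 0) (h3 : r ^ 3 ≠ s ^ 3) (g : Gen) :
    repU hr hs h3 (U.gen r s g) = genMat r s g :=
  (RingQuot.liftAlgHom_mkAlgHom_apply K (FreeAlgebra.lift K (genMat r s)) _ _).trans
    (FreeAlgebra.lift_ι_apply _ _)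

theorem repU_rel (hr : r ≠ 0) (hs : s ≠ 0) (h3 : r ^ 3 ≠ s ^ 3) {l : ℕ} (hl : 4 ≤ l)
    (hrl : r ^ l = 1) (hsl : s ^ l = 1) ⦃x y : U r s⦄ (h : RestrictedRel r s l x y) :
    repU hr hs h3 x = repU hr hs h3 y := by
  cases h with
  | E_pow α =>
    rw [map_pow, rootE_map, repU_gen, repU_gen, map_zero]
    exact rootE_pow_eq_zero (eMat_raises 0) (eMat_raises 1) eMat_zero_pow eMat_one_sq hl α
  | F_pow α =>
    have h₁ : (fMat r s 0)ᵀ ^ 3 = 0 := by rw [← transpose_pow, fMat_zero_pow, transpose_zero]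
    have h₂ : (fMat r s 1)ᵀ ^ 2 = 0 := by rw [← transpose_pow, fMat_one_sq, transpose_zero]
    rw [map_pow, rootF_map, repU_gen, repU_gen, map_zero, rootF_eq_transpose, ← transpose_pow]
    exact (congrArg transpose (rootE_pow_eq_zero (fMat_transpose_raises 0)
      (fMat_transpose_raises 1) h₁ h₂ hl α)).trans transpose_zero
  | w_pow k =>
    rw [map_pow, repU_gen, map_one, genMat, diagonal_pow, ← diagonal_one]
    exact congrArg diagonal (funext (wEigen_pow hrl hsl k))
  | w'_pow k =>
    rw [map_pow, repU_gen, map_one, genMat, diagonal_pow, ← diagonal_one]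
    exact congrArg diagonal (funext (w'Eigen_pow hrl hsl k))

/-- The `7`-dimensional representation of `𝔲_{r,s}(G₂)`. -/
def repSmallU (hr : r ≠ 0) (hs : s ≠ 0) (h3 : r ^ 3 ≠ s ^ 3) {l : ℕ} (hl : 4 ≤ l)
    (hrl : r ^ l = 1) (hsl : s ^ l = 1) : SmallU r s l →ₐ[K] Matrix (Fin 7) (Fin 7) K :=
  RingQuot.liftAlgHom K ⟨repU hr hs h3, repU_rel hr hs h3 hl hrl hsl⟩

theorem repSmallU_gen (hr : r ≠ 0) (hs : s ≠ 0) (h3 : r ^ 3 ≠ s ^ 3) {l : ℕ} (hl : 4 ≤ l)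
    (hrl : r ^ l = 1) (hsl : s ^ l = 1) (g : Gen) :
    repSmallU hr hs h3 hl hrl hsl (SmallU.gen r s l g) = genMat r s g :=
  (RingQuot.liftAlgHom_mkAlgHom_apply K (repU hr hs h3) _ _).trans (repU_gen hr hs h3 g)

end Representation

/-! ### Failure of semisimplicity -/

section Semisimple

/-- A semisimple ring is von Neumann regular. -/
theorem exists_mul_mul_eq_self_of_isSemisimpleRing {R : Type*} [Ring R] [IsSemisimpleRing R]
    (a : R) : ∃ c, a * c * a = a := by
  obtain ⟨J, hJ⟩ := exists_isCompl (Submodule.span R {a})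
  obtain ⟨x, hx, y, hy, hxy⟩ := Submodule.mem_sup.mp
    (hJ.sup_eq_top ▸ Submodule.mem_top (x := (1 : R)))
  obtain ⟨c, rfl⟩ := Submodule.mem_span_singleton.mp hx
  refine ⟨c, ?_⟩
  have h₁ : a * y = a - a * c * a := by
    rw [eq_sub_iff_add_eq', mul_assoc, ← mul_add, ← smul_eq_mul c a, hxy, mul_one]
  have h₂ : a * y ∈ Submodule.span R {a} := by
    rw [h₁]
    exact Submodule.mem_span_singleton.mpr ⟨1 - a * c, by simp [sub_mul]⟩
  have h₃ := Submodule.disjoint_def.mp hJ.disjoint _ h₂ (J.smul_mem a hy)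
  exact (sub_eq_zero.mp (h₁ ▸ h₃)).symm

open Matrix in
/-- The matrix unit `(0, 1)` entry of `e₁ c e₁` involves only the column of `c` at the highest
weight vector, which is an eigenvector of `𝔟`; so it vanishes, while `e₁` has entry `1`. -/
theorem not_isSemisimpleRing_borel {K : Type*} [Field K] {r s : K} (hr : r ≠ 0) (hs : s ≠ 0)
    (h3 : r ^ 3 ≠ s ^ 3) {l : ℕ} (hl : 4 ≤ l) (hrl : r ^ l = 1) (hsl : s ^ l = 1) :
    ¬ IsSemisimpleRing (borel r s l) := by
  intro _
  set ρ := repSmallU hr hs h3 hl hrl hsl with hρ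
  have hcol : ∀ c ∈ borel r s l, ∀ i, i ≠ 0 → ρ c i 0 = 0 := by
    intro c hc
    induction hc using Algebra.adjoin_induction with
    | mem c hc =>
      obtain ⟨_, ⟨j⟩ | ⟨j⟩ | ⟨j⟩, rfl⟩ := hc <;> intro i hi <;> rw [hρ, repSmallU_gen]
      · exact eMat_raises j i 0 (by simp)
      · exact diagonal_apply_ne _ hi
      · exact diagonal_apply_ne _ hi
    | algebraMap c =>
      intro i hi
      rw [AlgHom.commutes, algebraMap_eq_diagonal, diagonal_apply_ne _ hi]
    | add c c' _ _ h h' =>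
      intro i hi
      rw [map_add, Matrix.add_apply, h i hi, h' i hi, add_zero]
    | mul c c' _ _ h h' =>
      intro i hi
      rw [map_mul, mul_apply]
      refine Finset.sum_eq_zero fun x _ => ?_
      by_cases hx : x = 0
      · rw [hx, h i hi, zero_mul]
      · rw [h' x hx, mul_zero]
  obtain ⟨⟨c, hc⟩, h⟩ := exists_mul_mul_eq_self_of_isSemisimpleRing (be r s l 0)
  have h' : ρ (SmallU.gen r s l (.e 0)) * ρ c * ρ (SmallU.gen r s l (.e 0)) =
      ρ (SmallU.gen r s l (.e 0)) := by
    rw [← map_mul, ← map_mul]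
    exact congrArg ρ (congrArg Subtype.val h)
  rw [hρ, repSmallU_gen, ← hρ] at h'
  have h01 := congrFun (congrFun h' 0) 1
  simp [genMat, eMat, mul_apply, single, hcol c hc] at h01

end Semisimple

end G2Quantum

theorem proposition6p2 {K : Type*} [Field K] (r s : K) (d d' l : ℕ) (hl : 0 < l)
    (hr : IsPrimitiveRoot r d) (hs : IsPrimitiveRoot s d') (hld : l = Nat.lcm d d')
    (h3 : Nat.Coprime l 3) (hrs3 : r ^ 3 ≠ s ^ 3) (hrs4 : r ^ 4 ≠ s ^ 4) :
    G2Quantum.IsLeftIntegral (G2Quantum.borelCounit r s l hl)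
        (G2Quantum.tElt r s l * G2Quantum.xElt r s l) ∧
      G2Quantum.IsRightIntegral (G2Quantum.borelCounit r s l hl)
        (G2Quantum.xElt r s l * G2Quantum.tElt r s l) ∧
      ¬ IsSemisimpleRing (G2Quantum.borel r s l) := by
  have hrl : r ^ l = 1 := (hr.pow_eq_one_iff_dvd l).mpr (hld ▸ Nat.dvd_lcm_left d d')
  have hsl : s ^ l = 1 := (hs.pow_eq_one_iff_dvd l).mpr (hld ▸ Nat.dvd_lcm_right d d')
  have hr0 : r ≠ 0 := by rintro rfl; simp [hl.ne'] at hrl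
  have hs0 : s ≠ 0 := by rintro rfl; simp [hl.ne'] at hsl
  have h2 : r + s ≠ 0 := fun h => hrs4 (by linear_combination (r ^ 2 + s ^ 2) * (r - s) * h)
  have h4 : r ^ 2 + s ^ 2 ≠ 0 := fun h => hrs4 (by linear_combination (r ^ 2 - s ^ 2) * h)
  have h6 : r ^ 2 - r * s + s ^ 2 ≠ 0 := by
    intro h
    -- Then `(r / s) ^ 6 = 1`, and `gcd l 6` divides `2` as `l` is coprime to `3`.
    have hq6 : (r / s) ^ (3 * 2) = 1 := by
      rw [div_pow, div_eq_one_iff_eq (pow_ne_zero _ hs0)]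
      linear_combination (r + s) * (r ^ 3 - s ^ 3) * h
    have hql : (r / s) ^ l = 1 := by rw [div_pow, hrl, hsl, div_one]
    have hq : orderOf (r / s) ∣ 2 :=
      ((h3.coprime_dvd_left (orderOf_dvd_of_pow_eq_one hql))).dvd_of_dvd_mul_left
        (orderOf_dvd_of_pow_eq_one hq6)
    have hq2 : (r / s) ^ 2 = 1 := orderOf_dvd_iff_pow_eq_one.mp hq
    rw [div_pow, div_eq_one_iff_eq (pow_ne_zero _ hs0)] at hq2
    exact hrs4 (by linear_combination (r ^ 2 + s ^ 2) * hq2)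
  have hl4 : 4 ≤ l := by
    by_contra! hlt
    interval_cases l
    · exact hrs3 (by rw [show r = s by simpa using hrl.trans hsl.symm])
    · exact hrs4 (by linear_combination (r ^ 2 + s ^ 2) * (hrl.trans hsl.symm))
    · exact hrs3 (hrl.trans hsl.symm)
  exact ⟨G2Quantum.isLeftIntegral_tElt_mul_xElt hr0 hs0 h2 h4 h6 hl,
    G2Quantum.isRightIntegral_xElt_mul_tElt hr0 hs0 h2 h4 h6 hl,
    G2Quantum.not_isSemisimpleRing_borel hr0 hs0 hrs3 hl4 hrl hsl⟩
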